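/- **Setting.** Fix a set $\mathbf{dom}$ of constants that includes $\mathbb{Q}_{\ge 0}$, and relation names, each with a signature $(n,k,J)$: arity $n$, primary key formed by positions $1,\dots,k$, and a set $J$ of numerical positions. Some of the variables are numerical; valuations map numerical variables to $\mathbb{Q}_{\ge 0}$. An atom $R(u_1,\dots,u_n)$ has a variable or constant at each position, and a numerical variable or a number in $\mathbb{Q}_{\ge 0}$ at each numerical position; a fact is an atom without variables. A database instance is a finite set of facts; it is consistent if it contains no two distinct facts of the same relation that agree on the primary key. A repair of a database instance is a $\subseteq$-maximal consistent subset of it. **Queries.** Let $g()\coloneqq\mathtt{MIN}(r)\leftarrow q(\vec y)$, where $q(\vec y)$ is a conjunction of atoms with pairwise distinct relation names, $\vec y$ consists of all its variables, and $r$ is either a numerical variable in $\vec y$ or a constant in $\mathbb{Q}_{\ge 0}$. The value of $g()$ on a database instance is the minimum of the multiset of all numbers $\theta(r)$, where $\theta$ ranges over the valuations of $\vec y$ that map all atoms of $q$ to facts of the instance (on the empty multiset the value is an arbitrary fixed constant $f_0$). The body is *certain* in $\mathbf{db}$ if every repair of $\mathbf{db}$ satisfies $\exists\vec y\,q(\vec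 y)$. $\mathrm{GLB\text{-}CQA}(g())$ is the function that maps a database instance $\mathbf{db}$ to $\bot$ if the body is not certain in $\mathbf{db}$, and otherwise to the minimum, over all repairs $\mathbf r$ of $\mathbf{db}$, of the value of $g()$ on $\mathbf r$. **Attack graph.** For an atom $F$, let $\mathrm{vars}(F)$ be its set of variables and $\mathrm{key}(F)$ the set of those that occur at a primary-key position. Let $F^{+}$ be the set of variables $x$ of $q$ such that the functional dependency $\mathrm{key}(F)\to x$ is logically implied by $\{\mathrm{key}(G)\to\mathrm{vars}(G)\mid G\in q,\ G\neq F\}$. The atom $F$ attacks a variable $x$ if there is a sequence $x_1,\dots,x_m=x$ of variables outside $F^{+}$ with $x_1\in\mathrm{vars}(F)\setminus\mathrm{key}(F)$ such that any two adjacent ones occur together in some atom of $q$. The attack graph has the atoms of $q$ as vertices and an edge from $F$ to $G\neq F$ if $F$ attacks some variable of $G$. **Logic.** First-order logic with aggregation is predicate calculus with equality, with quantifiers ranging over $\mathbf{dom}$ (over $\mathbb{Q}_{\ge 0}$ for numerical variables), extended with numerical terms that may be compared by equality: numbers in $\mathbb{Q}_{\ge 0}$, numerical variables, and $\mathrm{Aggr}_{\mathcal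 F}\,\vec z\,[s,\varphi]$, for $\varphi$ a formula, $\vec z$ some of its free variables, $s$ a number in $\mathbb{Q}_{\ge 0}$ or a numerical variable free in $\varphi$, and $\mathcal F$ any aggregate operator, that is, a function that maps nonempty finite multisets over $\mathbb{Q}_{\ge 0}$ to $\mathbb{Q}_{\ge 0}$ and the empty multiset to some constant, possibly $\bot$. Such a term binds $\vec z$, and its value is $\mathcal F$ of the multiset of values of $s$ over all valuations of $\vec z$ that satisfy $\varphi$; it is required that there are finitely many of these on every database instance. A numerical query of the logic is a numerical term without free variables. **Theorem.** Let $g()\coloneqq\mathtt{MIN}(r)\leftarrow q(\vec y)$ be a query as above such that the attack graph of $\exists\vec y\,q(\vec y)$ is acyclic. Then $\mathrm{GLB\text{-}CQA}(g())$ is expressible in first-order logic with aggregation: there is a numerical query $t$ of that logic whose value on every database instance $\mathbf{db}$ is $\mathrm{GLB\text{-}CQA}(g())$ on $\mathbf{db}$. Moreover, for every database instance $\mathbf{db}$, the value of $\mathrm{GLB\text{-}CQA}(g())$ on $\mathbf{db}$ is the value of $g()$ on $\mathbf{db}$ itself if the body is certain in $\mathbf{db}$, and $\bot$ otherwise. 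-/

import Mathlib

/-! ## Relational schemas, variables, atoms, facts, databases -/

/-- The fixed relational setting: the set `Dom` of constants, which includes the non-negative
rationals (through `num`), and the relation names with their signatures `(n, k, J)`:
arity `n`, primary key formed by the first `k` positions, numerical positions `J`. -/
structure Schema where
  Dom : Type
  num : NNRat ↪ Dom
  Rel : Type
  arity : Rel → ℕ
  keyLen : Rel → ℕ
  keyLen_le : ∀ R, keyLen R ≤ arity R
  numeric : ∀ R, Set (Fin (arity R))

/-- Variables; the variables `num n` are the numerical ones. -/
inductive Var where
  | obj (n : ℕ)
  | num (n : ℕ)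
  deriving DecidableEq

/-- Primitive numerical terms: numerical variables and non-negative rational numbers. -/
inductive NumPrim where
  | var (n : ℕ)
  | const (c : NNRat)

/-- A variable or a constant. -/
inductive Term (S : Schema) where
  | var (x : Var)
  | const (c : S.Dom)

def NumPrim.toTerm (S : Schema) : NumPrim → Term S
  | .var n => .var (.num n)
  | .const c => .const (S.num c)

def NumPrim.vars : NumPrim → Finset Var
  | .var n => {Var.num n}
  | .const _ => ∅

def Term.vars {S : Schema} : Term S → Finset Var
  | .var x => {x}
  | .const _ => ∅

/-- An atom `R(u₁, …, uₙ)`; numerical positions hold numerical variables or numbers. -/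
structure Atom (S : Schema) where
  rel : S.Rel
  args : Fin (S.arity rel) → Term S
  numeric_args : ∀ j ∈ S.numeric rel, ∃ p : NumPrim, args j = p.toTerm S

namespace Atom

variable {S : Schema}

def vars (F : Atom S) : Finset Var :=
  Finset.univ.biUnion fun i => (F.args i).vars

/-- The variables that occur at a position of the primary key. -/
def keyVars (F : Atom S) : Finset Var :=
  (Finset.univ.filter fun i : Fin (S.arity F.rel) => i.val < S.keyLen F.rel).biUnion
    fun i => (F.args i).vars

def notKeyVars (F : Atom S) : Finset Var := F.vars \ F.keyVars

end Atom

/-- A fact: an atom without variables. -/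
structure DbFact (S : Schema) where
  rel : S.Rel
  args : Fin (S.arity rel) → S.Dom
  numeric_args : ∀ j ∈ S.numeric rel, args j ∈ Set.range S.num

/-- Same relation name and same primary-key values. -/
def DbFact.KeyEqual {S : Schema} (A B : DbFact S) : Prop :=
  ∃ h : A.rel = B.rel, ∀ i : Fin (S.arity A.rel), i.val < S.keyLen A.rel →
    A.args i = B.args (Fin.cast (congrArg S.arity h) i)

/-- A database instance: a finite set of facts, possibly violating the primary keys. -/
abbrev Database (S : Schema) := Finset (DbFact S)

namespace Database

variable {S : Schema}

def Consistent (db : Database S) : Prop :=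
  ∀ A ∈ db, ∀ B ∈ db, A.KeyEqual B → A = B

/-- A repair of `db`: an inclusion-maximal consistent subset of `db`. -/
def IsRepair (db r : Database S) : Prop :=
  Maximal (fun s : Database S => s ⊆ db ∧ s.Consistent) r

end Database

/-! ## Valuations -/

/-- A total valuation of the variables; numerical variables take values in the non-negative
rationals.  A valuation over a set `U` of variables is represented by any total valuation that
coincides with it on `U`. -/
structure VarValuation (S : Schema) where
  onObj : ℕ → S.Dom
  onNum : ℕ → NNRat

namespace VarValuation

variable {S : Schema}

def get (θ : VarValuation S) : Var → S.Dom
  | .obj n => θ.onObj n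
  | .num n => S.num (θ.onNum n)

def termVal (θ : VarValuation S) : Term S → S.Dom
  | .var x => θ.get x
  | .const c => c

def primVal (θ : VarValuation S) : NumPrim → NNRat
  | .var n => θ.onNum n
  | .const c => c

theorem termVal_toTerm (θ : VarValuation S) (p : NumPrim) :
    θ.termVal (p.toTerm S) = S.num (θ.primVal p) := by
  cases p <;> rfl

/-- The fact `θ(F)`. -/
def ground (θ : VarValuation S) (F : Atom S) : DbFact S where
  rel := F.rel
  args := fun i => θ.termVal (F.args i)
  numeric_args := by
    intro j hj
    obtain ⟨p, hp⟩ := F.numeric_args j hj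
    exact ⟨θ.primVal p, by rw [hp, termVal_toTerm]⟩

/-- `τ` coincides with `θ` on every variable outside `ys`. -/
def AgreeOff (ys : Finset Var) (θ τ : VarValuation S) : Prop :=
  ∀ x, x ∉ ys → τ.get x = θ.get x

/-- A fixed valuation, used to evaluate expressions without free variables. -/
def zero (S : Schema) : VarValuation S where
  onObj := fun _ => S.num 0
  onNum := fun _ => 0

end VarValuation

/-! ## Aggregate operators -/

/-- A (positive) aggregate operator: a function from finite multisets of non-negative rationals
that is non-negative rational on nonempty multisets and takes an arbitrary constant value on the
empty one.  The value `none` stands for the distinguished non-numerical constant `⊥`. -/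
structure AggOp where
  onEmpty : Option NNRat
  onNonempty : (X : Multiset NNRat) → X ≠ 0 → NNRat

def AggOp.apply (F : AggOp) (X : Multiset NNRat) : Option NNRat :=
  if h : X = 0 then F.onEmpty else some (F.onNonempty X h)

/-- The minimum, with the convention that its value on the empty multiset is `f₀`. -/
def AggOp.min (f₀ : Option NNRat) : AggOp where
  onEmpty := f₀
  onNonempty := fun X h => X.toFinset.min' (by simpa using h)

/-! ## First-order logic with aggregation -/

mutual

/-- Numerical terms: primitive ones, and `Aggr_F ys [r, φ]`, which binds the variables `ys`. -/
inductive NumTerm (S : Schema) where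
  | prim (p : NumPrim)
  | agg (F : AggOp) (ys : Finset Var) (r : NumPrim) (φ : Formula S)

/-- Formulas: predicate calculus with equality over the relation names and the constants,
extended by equalities between numerical terms. -/
inductive Formula (S : Schema) where
  | verum
  | atom (F : Atom S)
  | eq (s t : Term S)
  | numEq (s t : NumTerm S)
  | neg (φ : Formula S)
  | and (φ ψ : Formula S)
  | ex (x : Var) (φ : Formula S)

end

mutual

/-- Free variables of a numerical term. -/
def NumTerm.freeVars {S : Schema} : NumTerm S → Finset Var
  | .prim p => p.vars
  | .agg _ ys r φ => (r.vars ∪ φ.freeVars) \ ys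

/-- Free variables of a formula. -/
def Formula.freeVars {S : Schema} : Formula S → Finset Var
  | .verum => ∅
  | .atom F => F.vars
  | .eq s t => s.vars ∪ t.vars
  | .numEq s t => s.freeVars ∪ t.freeVars
  | .neg φ => φ.freeVars
  | .and φ ψ => φ.freeVars ∪ ψ.freeVars
  | .ex x φ => φ.freeVars \ {x}

end

open Classical in
/-- `F` applied to the multiset of the numbers `θ(r)`, where `θ` ranges over the finite set `Θ`
of valuations.  The value for infinite `Θ` is immaterial: see `NumTerm.WellFormed`. -/
noncomputable def AggOp.over {S : Schema} (F : AggOp) (Θ : Set (VarValuation S)) (r : NumPrim) :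
    Option NNRat :=
  if h : Θ.Finite then F.apply (h.toFinset.val.map fun θ => θ.primVal r) else F.onEmpty

mutual

/-- The value of a numerical term on `db`, under a valuation of its free variables. -/
noncomputable def NumTerm.eval {S : Schema} (db : Database S) :
    NumTerm S → VarValuation S → Option NNRat
  | .prim p, θ => some (θ.primVal p)
  | .agg F ys r φ, θ => F.over {τ | θ.AgreeOff ys τ ∧ φ.Holds db τ} r

/-- Satisfaction of a formula in `db`; variables range over all constants, numerical variables
over all non-negative rationals. -/
noncomputable def Formula.Holds {S : Schema} (db : Database S) : Formula S → VarValuation S → Prop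
  | .verum, _ => True
  | .atom F, θ => θ.ground F ∈ db
  | .eq s t, θ => θ.termVal s = θ.termVal t
  | .numEq s t, θ => s.eval db θ = t.eval db θ
  | .neg φ, θ => ¬ φ.Holds db θ
  | .and φ ψ, θ => φ.Holds db θ ∧ ψ.Holds db θ
  | .ex x φ, θ => ∃ τ, θ.AgreeOff {x} τ ∧ φ.Holds db τ

end

mutual

/-- In every aggregation `Aggr_F ys [r, φ]`, the variables `ys` and the variable of `r` are free
in `φ`, and the aggregated multiset is finite on every database instance. -/
def NumTerm.WellFormed {S : Schema} : NumTerm S → Prop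
  | .prim _ => True
  | .agg _ ys r φ => ys ⊆ φ.freeVars ∧ r.vars ⊆ φ.freeVars ∧ φ.WellFormed ∧
      ∀ (db : Database S) (θ : VarValuation S), {τ | θ.AgreeOff ys τ ∧ φ.Holds db τ}.Finite

/-- All aggregations inside the formula are well-formed. -/
def Formula.WellFormed {S : Schema} : Formula S → Prop
  | .verum => True
  | .atom _ => True
  | .eq _ _ => True
  | .numEq s t => s.WellFormed ∧ t.WellFormed
  | .neg φ => φ.WellFormed
  | .and φ ψ => φ.WellFormed ∧ ψ.WellFormed
  | .ex _ φ => φ.WellFormed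

end

/-- A numerical query of first-order logic with aggregation: a well-formed numerical term without
free variables. -/
def NumTerm.IsNumQuery {S : Schema} (t : NumTerm S) : Prop :=
  t.WellFormed ∧ t.freeVars = ∅

/-- The value of a numerical query on `db` (there are no free variables, so that the valuation
plays no role). -/
noncomputable def NumTerm.value {S : Schema} (t : NumTerm S) (db : Database S) : Option NNRat :=
  t.eval db (VarValuation.zero S)

/-! ## Conjunctive queries and attack graphs -/

/-- A conjunction of atoms, given by the list of its atoms. -/
abbrev CQ (S : Schema) := List (Atom S)

namespace CQ

variable {S : Schema}

def vars (q : CQ S) : Finset Var := q.foldr (fun F U => F.vars ∪ U) ∅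

/-- The conjunction as a formula. -/
def body (q : CQ S) : Formula S := q.foldr (fun F φ => .and (.atom F) φ) .verum

/-- No relation name occurs in two atoms. -/
def SelfJoinFree (q : CQ S) : Prop := (q.map Atom.rel).Nodup

/-- `db` satisfies the Boolean query obtained by quantifying all variables existentially. -/
def SatisfiedIn (q : CQ S) (db : Database S) : Prop :=
  ∃ θ : VarValuation S, ∀ F ∈ q, θ.ground F ∈ db

/-- Every repair of `db` satisfies the Boolean query. -/
def CertainIn (q : CQ S) (db : Database S) : Prop :=
  ∀ r, db.IsRepair r → q.SatisfiedIn r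

end CQ

/-- A functional dependency `lhs → rhs` between sets of variables. -/
structure FD where
  lhs : Finset Var
  rhs : Finset Var

/-- The relation `M` (a set of tuples over the variables) satisfies the dependency. -/
def FD.HoldsIn (σ : FD) (M : Set (Var → ℕ)) : Prop :=
  ∀ s ∈ M, ∀ t ∈ M, (∀ x ∈ σ.lhs, s x = t x) → ∀ x ∈ σ.rhs, s x = t x

/-- Logical implication of functional dependencies. -/
def FD.Implies (K : Set FD) (σ : FD) : Prop :=
  ∀ M : Set (Var → ℕ), (∀ κ ∈ K, κ.HoldsIn M) → σ.HoldsIn M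

namespace CQ

variable {S : Schema}

/-- The functional dependencies `key(G) → vars(G)` for the atoms `G ≠ F` of `q`. -/
def fdsWithout (q : CQ S) (F : Atom S) : Set FD :=
  {σ | ∃ G ∈ q, G ≠ F ∧ σ = ⟨G.keyVars, G.vars⟩}

/-- The variables of `q` that are determined by `key(F)` through the other atoms of `q`. -/
def keyClosure (q : CQ S) (F : Atom S) : Set Var :=
  {x | x ∈ q.vars ∧ FD.Implies (q.fdsWithout F) ⟨F.keyVars, {x}⟩}

/-- The atom `F` attacks the variable `x`. -/
def AttacksVar (q : CQ S) (F : Atom S) (x : Var) : Prop :=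
  ∃ (m : ℕ) (w : Fin (m + 1) → Var), w 0 ∈ F.notKeyVars ∧ w (Fin.last m) = x ∧
    (∀ i, w i ∉ q.keyClosure F) ∧
    ∀ i : Fin m, ∃ G ∈ q, w i.castSucc ∈ G.vars ∧ w i.succ ∈ G.vars

/-- The edges of the attack graph, a loopless directed graph on the atoms of `q`. -/
def Attacks (q : CQ S) (F G : Atom S) : Prop :=
  F ∈ q ∧ G ∈ q ∧ F ≠ G ∧ ∃ x ∈ G.vars, q.AttacksVar F x

/-- The attack graph has no directed cycle. -/
def AcyclicAttackGraph (q : CQ S) : Prop :=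
  ∀ F, ¬ Relation.TransGen q.Attacks F F

end CQ

/-! ## Aggregation queries and greatest lower bounds over repairs -/

/-- A query `AGG(r) ← q(y)` with self-join-free body; `r` is a numerical variable of the body or a
non-negative rational number. -/
structure AggQuery (S : Schema) where
  op : AggOp
  head : NumPrim
  body : CQ S
  selfJoinFree : body.SelfJoinFree
  head_vars : head.vars ⊆ body.vars

namespace AggQuery

variable {S : Schema}

/-- The numerical term `Aggr_AGG y [r, q(y)]`. -/
def toNumTerm (g : AggQuery S) : NumTerm S :=
  .agg g.op g.body.vars g.head g.body.body

/-- `a` is the answer to `GLB-CQA(g())` on `db`: it is `⊥` (that is, `none`) if some repair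
falsifies the body, and otherwise the least value of the query over all repairs. -/
def IsGlbCQA (g : AggQuery S) (db : Database S) : Option NNRat → Prop
  | none => ∃ r, db.IsRepair r ∧ ¬ g.body.SatisfiedIn r
  | some v => (∀ r, db.IsRepair r → g.body.SatisfiedIn r) ∧
      IsLeast {u : NNRat | ∃ r, db.IsRepair r ∧ g.toNumTerm.value r = some u} v

/-- Some numerical query of first-order logic with aggregation computes `GLB-CQA(g())` on every
database instance. -/
def GlbExpressible (g : AggQuery S) : Prop :=
  ∃ t : NumTerm S, t.IsNumQuery ∧ ∀ db : Database S, g.IsGlbCQA db (t.value db)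

end AggQuery

/-!
Once the values of the variables in a set `V` are fixed, these variables behave like constants, and
fixing more of them only removes attacks.  If two embeddings of the query into consistent sets of
facts disagree on one block only, that of the atom `F`, then they can be glued: the result follows
the first one on the variables attacked by `F` and the second one elsewhere.  Hence exchanging a
fact of a repair for one of another repair, when that fact is used by an embedding, creates no new
instantiations of variables that no atom attacks; since there are finitely many repairs, one of
them has only instantiations that all repairs share.

Therefore the key of an unattacked atom of a certain query can be instantiated in the same way in
all repairs, and with this key fixed, certainty means that the corresponding block is nonempty and
that each of its facts leaves the remaining query certain.  Recursion over the acyclic attack graph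
turns this into a first-order formula.

As no relation name is repeated, every embedding into the database has a consistent image and
survives in some repair.  So the minimum over all repairs is the minimum over the database itself.
Conjoining the sentence that expresses certainty to the body of the query empties the aggregated
multiset when the body is not certain, and there the minimum may be given the value `⊥`.
-/

/-! ## Blocks and repairs -/

namespace DbFact

variable {S : Schema} {A B C : DbFact S}

theorem KeyEqual.refl (A : DbFact S) : A.KeyEqual A := ⟨rfl, fun _ _ => rfl⟩

theorem KeyEqual.symm (h : A.KeyEqual B) : B.KeyEqual A := by
  obtain ⟨R, a, _⟩ := A
  obtain ⟨R', b, _⟩ := B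
  obtain ⟨rfl : R = R', hargs⟩ := h
  exact ⟨rfl, fun i hi => (hargs i hi).symm⟩

theorem KeyEqual.trans (hAB : A.KeyEqual B) (hBC : B.KeyEqual C) : A.KeyEqual C := by
  obtain ⟨R, a, _⟩ := A
  obtain ⟨R', b, _⟩ := B
  obtain ⟨R'', c, _⟩ := C
  obtain ⟨rfl : R = R', hab⟩ := hAB
  obtain ⟨rfl : R = R'', hbc⟩ := hBC
  exact ⟨rfl, fun i hi => (hab i hi).trans (hbc i hi)⟩

theorem KeyEqual.rel_eq (h : A.KeyEqual B) : A.rel = B.rel := h.1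

theorem eq_iff_exists_args_eq :
    A = B ↔ ∃ h : A.rel = B.rel, ∀ i, A.args i = B.args (Fin.cast (congrArg S.arity h) i) := by
  refine ⟨fun h => h ▸ ⟨rfl, fun _ => rfl⟩, fun h => ?_⟩
  obtain ⟨R, a, _⟩ := A
  obtain ⟨R', b, _⟩ := B
  obtain ⟨rfl : R = R', hargs⟩ := h
  obtain rfl : a = b := funext hargs
  rfl

end DbFact

namespace Database

variable {S : Schema} {db r s : Database S} {A B C : DbFact S}

theorem finite_setOf_isRepair (db : Database S) : {r | db.IsRepair r}.Finite :=
  db.powerset.finite_toSet.subset fun _ hr => Finset.mem_powerset.2 hr.1.1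

theorem exists_isRepair_superset (hs : s ⊆ db) (hcons : s.Consistent) :
    ∃ r, db.IsRepair r ∧ s ⊆ r := by
  have hfin : {t : Database S | t ⊆ db ∧ t.Consistent}.Finite :=
    db.powerset.finite_toSet.subset fun t ht => Finset.mem_powerset.2 ht.1
  obtain ⟨r, hsr, hr⟩ := hfin.exists_le_maximal (a := s) ⟨hs, hcons⟩
  exact ⟨r, hr, hsr⟩

theorem exists_isRepair (db : Database S) : ∃ r, db.IsRepair r :=
  (exists_isRepair_superset (Finset.empty_subset db) (by simp [Consistent])).imp fun _ => And.left

theorem exists_isRepair_mem (hA : A ∈ db) : ∃ r, db.IsRepair r ∧ A ∈ r := by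
  obtain ⟨r, hr, hAr⟩ := exists_isRepair_superset (Finset.singleton_subset_iff.2 hA)
    (by simp [Consistent])
  exact ⟨r, hr, Finset.singleton_subset_iff.1 hAr⟩

open Classical in
theorem Consistent.insert (hs : s.Consistent) (hA : ∀ B ∈ s, ¬ A.KeyEqual B) :
    (insert A s : Database S).Consistent := by
  intro B hB C hC hBC
  rcases Finset.mem_insert.1 hB with rfl | hBs <;> rcases Finset.mem_insert.1 hC with rfl | hCs
  · rfl
  · exact absurd hBC (hA C hCs)
  · exact absurd hBC.symm (hA B hBs)
  · exact hs B hBs C hCs hBC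

theorem IsRepair.subset (hr : db.IsRepair r) : r ⊆ db := hr.1.1

theorem IsRepair.consistent (hr : db.IsRepair r) : r.Consistent := hr.1.2

theorem IsRepair.exists_keyEqual (hr : db.IsRepair r) (hA : A ∈ db) : ∃ B ∈ r, A.KeyEqual B := by
  classical
  by_contra! hno
  have hAr : A ∈ r := hr.2 ⟨Finset.insert_subset hA hr.subset, hr.consistent.insert hno⟩
    (Finset.subset_insert A r) (Finset.mem_insert_self A r)
  exact hno A hAr (.refl A)

theorem isRepair_iff :
    db.IsRepair r ↔ r ⊆ db ∧ r.Consistent ∧ ∀ A ∈ db, ∃ B ∈ r, A.KeyEqual B := by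
  refine ⟨fun hr => ⟨hr.subset, hr.consistent, fun _ => hr.exists_keyEqual⟩, ?_⟩
  rintro ⟨hsub, hcons, hblocks⟩
  refine ⟨⟨hsub, hcons⟩, fun s hs hrs A hA => ?_⟩
  obtain ⟨B, hB, hAB⟩ := hblocks A (hs.1 hA)
  rwa [hs.2 A hA B (hrs hB) hAB]

open Classical in
/-- The result of exchanging the fact `B` of `r` for `A`. -/
noncomputable def replace (r : Database S) (B A : DbFact S) : Database S := insert A (r.erase B)

theorem mem_replace : C ∈ r.replace B A ↔ C = A ∨ C ≠ B ∧ C ∈ r := by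
  simp only [replace, Finset.mem_insert, Finset.mem_erase]

theorem IsRepair.replace (hr : db.IsRepair r) (hA : A ∈ db) (hB : B ∈ r) (hAB : A.KeyEqual B) :
    db.IsRepair (r.replace B A) := by
  classical
  refine isRepair_iff.2 ⟨fun C hC => ?_, Consistent.insert ?_ ?_, fun C hC => ?_⟩
  · rcases mem_replace.1 hC with rfl | ⟨-, hCr⟩
    exacts [hA, hr.subset hCr]
  · exact fun C hC D hD => hr.consistent C (Finset.mem_of_mem_erase hC) D
      (Finset.mem_of_mem_erase hD)
  · intro C hC hAC
    exact Finset.ne_of_mem_erase hC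
      (hr.consistent C (Finset.mem_of_mem_erase hC) B hB (hAC.symm.trans hAB))
  · obtain ⟨D, hD, hCD⟩ := hr.exists_keyEqual hC
    obtain rfl | hDB := eq_or_ne D B
    · exact ⟨A, mem_replace.2 (.inl rfl), hCD.trans hAB.symm⟩
    · exact ⟨D, mem_replace.2 (.inr ⟨hDB, hD⟩), hCD⟩

open Classical in
theorem replace_sdiff_ssubset (hA : A ∈ r) (hBs : B ∈ s) (hBr : B ∉ r) :
    s.replace B A \ r ⊂ s \ r := by
  refine (Finset.ssubset_iff_of_subset fun C hC => ?_).2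
    ⟨B, Finset.mem_sdiff.2 ⟨hBs, hBr⟩, fun hB => ?_⟩
  · obtain ⟨hC, hCr⟩ := Finset.mem_sdiff.1 hC
    obtain rfl | ⟨-, hCs⟩ := mem_replace.1 hC
    exacts [absurd hA hCr, Finset.mem_sdiff.2 ⟨hCs, hCr⟩]
  · obtain rfl | ⟨hne, -⟩ := mem_replace.1 (Finset.mem_sdiff.1 hB).1
    exacts [hBr hA, hne rfl]

end Database

/-! ## Valuations -/

namespace Atom

variable {S : Schema} {F : Atom S} {x : Var}

theorem mem_vars : x ∈ F.vars ↔ ∃ i, x ∈ (F.args i).vars := by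
  simp [vars]

theorem mem_keyVars :
    x ∈ F.keyVars ↔ ∃ i : Fin (S.arity F.rel), i.val < S.keyLen F.rel ∧ x ∈ (F.args i).vars := by
  simp [keyVars]

theorem keyVars_subset_vars (F : Atom S) : F.keyVars ⊆ F.vars := by
  intro x hx
  obtain ⟨i, -, hi⟩ := mem_keyVars.1 hx
  exact mem_vars.2 ⟨i, hi⟩

end Atom

namespace VarValuation

variable {S : Schema} {θ τ : VarValuation S}

theorem get_injective : Function.Injective (get : VarValuation S → Var → S.Dom) := by
  rintro ⟨o, n⟩ ⟨o', n'⟩ h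
  obtain rfl : o = o' := funext fun k => congrFun h (.obj k)
  obtain rfl : n = n' := funext fun k => S.num.injective (congrFun h (.num k))
  rfl

theorem get_num_mem_range (θ : VarValuation S) (n : ℕ) : θ.get (.num n) ∈ Set.range S.num :=
  ⟨θ.onNum n, rfl⟩

theorem exists_get_eq {v : Var → S.Dom} (hv : ∀ n, v (.num n) ∈ Set.range S.num) :
    ∃ θ : VarValuation S, θ.get = v := by
  choose c hc using hv
  refine ⟨⟨fun n => v (.obj n), c⟩, funext fun x => ?_⟩
  cases x with
  | obj n => rfl
  | num n => exact hc n

theorem exists_piecewise (U : Set Var) (θ τ : VarValuation S) :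
    ∃ ρ : VarValuation S, Set.EqOn ρ.get θ.get U ∧ Set.EqOn ρ.get τ.get Uᶜ := by
  classical
  obtain ⟨ρ, hρ⟩ := exists_get_eq (v := U.piecewise θ.get τ.get) fun n => by
    by_cases hn : Var.num n ∈ U
    · simpa only [Set.piecewise_eq_of_mem _ _ _ hn] using θ.get_num_mem_range n
    · simpa only [Set.piecewise_eq_of_notMem _ _ _ hn] using τ.get_num_mem_range n
  exact ⟨ρ, hρ ▸ Set.piecewise_eqOn _ _ _, hρ ▸ Set.piecewise_eqOn_compl _ _ _⟩

theorem agreeOff_iff {ys : Finset Var} : θ.AgreeOff ys τ ↔ Set.EqOn τ.get θ.get (ys : Set Var)ᶜ :=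
  Iff.rfl

theorem AgreeOff.eqOn {ys : Finset Var} (h : θ.AgreeOff ys τ) {U : Set Var}
    (hU : Disjoint U ys) : Set.EqOn θ.get τ.get U :=
  (agreeOff_iff.1 h).symm.mono hU.subset_compl_right

theorem exists_agreeOff_eqOn (ys : Finset Var) (θ τ : VarValuation S) :
    ∃ ρ, θ.AgreeOff ys ρ ∧ Set.EqOn ρ.get τ.get ys :=
  (exists_piecewise ys τ θ).imp fun _ => And.symm

theorem termVal_eq_iff {t : Term S} :
    θ.termVal t = τ.termVal t ↔ Set.EqOn θ.get τ.get t.vars := by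
  cases t <;> simp [termVal, Term.vars]

theorem ground_eq_iff {F : Atom S} :
    θ.ground F = τ.ground F ↔ Set.EqOn θ.get τ.get F.vars := by
  refine DbFact.eq_iff_exists_args_eq.trans ⟨?_, fun h => ⟨rfl, fun i => ?_⟩⟩
  · rintro ⟨_, hargs⟩ x hx
    obtain ⟨i, hi⟩ := Atom.mem_vars.1 hx
    exact termVal_eq_iff.1 (hargs i) hi
  · exact termVal_eq_iff.2 fun x hx => h (Atom.mem_vars.2 ⟨i, hx⟩)

theorem keyEqual_ground_iff {F : Atom S} :
    (θ.ground F).KeyEqual (τ.ground F) ↔ Set.EqOn θ.get τ.get F.keyVars := by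
  refine ⟨?_, fun h => ⟨rfl, fun i hi => ?_⟩⟩
  · rintro ⟨_, hargs⟩ x hx
    obtain ⟨i, hkey, hi⟩ := Atom.mem_keyVars.1 hx
    exact termVal_eq_iff.1 (hargs i hkey) hi
  · exact termVal_eq_iff.2 fun x hx => h (Atom.mem_keyVars.2 ⟨i, hi, hx⟩)

end VarValuation

/-! ## Attacks under fixed values of some variables -/

namespace FD

theorem holdsIn_pair_iff {σ : FD} {s t : Var → ℕ} :
    σ.HoldsIn {s, t} ↔ (Set.EqOn s t σ.lhs → Set.EqOn s t σ.rhs) := by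
  refine ⟨fun h => h s (.inl rfl) t (.inr rfl), fun h a ha b hb => ?_⟩
  obtain rfl | rfl := ha <;> obtain rfl | rfl := hb
  · exact fun _ _ _ => rfl
  · exact h
  · exact fun heq => (h (Set.EqOn.symm heq)).symm
  · exact fun _ _ _ => rfl

theorem Implies.subset_of_closed {K : Set FD} {σ : FD} (h : FD.Implies K σ) {U : Set Var}
    (hU : ∀ κ ∈ K, (κ.lhs : Set Var) ⊆ U → (κ.rhs : Set Var) ⊆ U) (hσ : (σ.lhs : Set Var) ⊆ U) :
    (σ.rhs : Set Var) ⊆ U := by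
  -- Two tuples that coincide exactly on `U` satisfy `K`.
  obtain ⟨s, t, hst⟩ : ∃ s t : Var → ℕ, ∀ W : Set Var, Set.EqOn s t W ↔ W ⊆ U :=
    ⟨0, Uᶜ.indicator 1, fun W => by simp [Set.EqOn, Set.subset_def, Set.indicator]⟩
  have hpair := h {s, t} fun κ hκ => by simpa only [holdsIn_pair_iff, hst] using hU κ hκ
  rw [holdsIn_pair_iff, hst, hst] at hpair
  exact hpair hσ

end FD

namespace CQ

variable {S : Schema} {q : CQ S} {V : Set Var} {F G : Atom S} {x y : Var}

theorem mem_vars : x ∈ q.vars ↔ ∃ F ∈ q, x ∈ F.vars := by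
  induction q with
  | nil => simp [vars]
  | cons F q ih => simp only [vars, List.foldr_cons, Finset.mem_union] at ih ⊢; simp [ih]

theorem SelfJoinFree.eq_of_rel_eq (hq : q.SelfJoinFree) (hF : F ∈ q) (hG : G ∈ q)
    (hrel : F.rel = G.rel) : F = G :=
  List.inj_on_of_nodup_map hq hF hG hrel

/-- The variables determined by `key(F)` through the other atoms of `q` once the values of the
variables in `V` are fixed; for `V = ∅`, these are the variables in `F⁺`. -/
inductive KeyDetermines (q : CQ S) (V : Set Var) (F : Atom S) : Var → Prop
  | fixed {x : Var} : x ∈ V → KeyDetermines q V F x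
  | key {x : Var} : x ∈ F.keyVars → KeyDetermines q V F x
  | step {G : Atom S} {x : Var} : G ∈ q → G ≠ F → (∀ y ∈ G.keyVars, KeyDetermines q V F y) →
      x ∈ G.vars → KeyDetermines q V F x

theorem keyDetermines_of_mem_keyClosure (hx : x ∈ q.keyClosure F) : q.KeyDetermines ∅ F x := by
  have hclosed : ∀ κ ∈ q.fdsWithout F, (κ.lhs : Set Var) ⊆ {y | q.KeyDetermines ∅ F y} →
      (κ.rhs : Set Var) ⊆ {y | q.KeyDetermines ∅ F y} := by
    rintro _ ⟨G, hG, hGF, rfl⟩ hkey y hy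
    exact KeyDetermines.step hG hGF hkey hy
  exact hx.2.subset_of_closed hclosed (fun y hy => .key hy) (Finset.mem_singleton_self x)

/-- `F` attacks the variable once the values of the variables in `V` are fixed: fixed variables
are treated as constants. -/
inductive AttacksVarFixing (q : CQ S) (V : Set Var) (F : Atom S) : Var → Prop
  | start {x : Var} : x ∈ F.vars → ¬ q.KeyDetermines V F x → AttacksVarFixing q V F x
  | step {G : Atom S} {x y : Var} : AttacksVarFixing q V F x → G ∈ q → x ∈ G.vars → y ∈ G.vars →
      ¬ q.KeyDetermines V F y → AttacksVarFixing q V F y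

theorem AttacksVarFixing.not_keyDetermines (h : q.AttacksVarFixing V F x) :
    ¬ q.KeyDetermines V F x := by
  cases h <;> assumption

theorem AttacksVar.start (hx : x ∈ F.notKeyVars) (hcl : x ∉ q.keyClosure F) : q.AttacksVar F x :=
  ⟨0, fun _ => x, hx, rfl, fun _ => hcl, fun i => i.elim0⟩

theorem AttacksVar.step (h : q.AttacksVar F x) (hG : G ∈ q) (hx : x ∈ G.vars) (hy : y ∈ G.vars)
    (hcl : y ∉ q.keyClosure F) : q.AttacksVar F y := by
  obtain ⟨m, w, hw0, rfl, hwcl, hadj⟩ := h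
  refine ⟨m + 1, Fin.snoc (α := fun _ => Var) w y, ?_, by simp, fun i => ?_, fun i => ?_⟩
  · rwa [← Fin.castSucc_zero, Fin.snoc_castSucc]
  · cases i using Fin.lastCases with
    | last => rwa [Fin.snoc_last]
    | cast j => rw [Fin.snoc_castSucc]; exact hwcl j
  · cases i using Fin.lastCases with
    | last => rw [Fin.succ_last, Fin.snoc_last, Fin.snoc_castSucc]; exact ⟨G, hG, hx, hy⟩
    | cast j => rw [Fin.succ_castSucc, Fin.snoc_castSucc, Fin.snoc_castSucc]; exact hadj j

theorem AttacksVarFixing.attacksVar (h : q.AttacksVarFixing ∅ F x) : q.AttacksVar F x := by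
  induction h with
  | start hx hdet =>
    exact .start (Finset.mem_sdiff.2 ⟨hx, fun hkey => hdet (.key hkey)⟩)
      fun hcl => hdet (keyDetermines_of_mem_keyClosure hcl)
  | step _ hG hx hy hdet ih =>
    exact ih.step hG hx hy fun hcl => hdet (keyDetermines_of_mem_keyClosure hcl)

/-- The edges of the attack graph once the values of the variables in `V` are fixed. -/
def AttacksFixing (q : CQ S) (V : Set Var) (F G : Atom S) : Prop :=
  F ∈ q ∧ G ∈ q ∧ F ≠ G ∧ ∃ x ∈ G.vars, q.AttacksVarFixing V F x

/-- The attack graph has no directed cycle once the values of the variables in `V` are fixed. -/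
def AcyclicFixing (q : CQ S) (V : Set Var) : Prop :=
  ∀ F, ¬ Relation.TransGen (q.AttacksFixing V) F F

theorem AcyclicAttackGraph.acyclicFixing (h : q.AcyclicAttackGraph) : q.AcyclicFixing ∅ :=
  fun F hF => h F (Relation.TransGen.mono (fun _ _ ⟨hA, hB, hne, x, hx, hatt⟩ =>
    ⟨hA, hB, hne, x, hx, hatt.attacksVar⟩) F F hF)

open Classical in
/-- The conjunction without the atom `F`. -/
noncomputable def without (q : CQ S) (F : Atom S) : CQ S := q.filter (· ≠ F)

theorem mem_without : G ∈ q.without F ↔ G ∈ q ∧ G ≠ F := by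
  simp [without]

theorem length_without_lt (hF : F ∈ q) : (q.without F).length < q.length := by
  classical
  exact List.length_filter_lt_length_iff_exists.2 ⟨F, hF, by simp⟩

theorem SelfJoinFree.without (hq : q.SelfJoinFree) (F : Atom S) : (q.without F).SelfJoinFree :=
  hq.sublist (List.filter_sublist.map _)

theorem KeyDetermines.without (h : q.KeyDetermines V G x) (F : Atom S) :
    (q.without F).KeyDetermines (V ∪ F.vars) G x := by
  induction h with
  | fixed hx => exact .fixed (.inl hx)
  | key hx => exact .key hx
  | @step H x hH hHG _ hx ih =>
    obtain rfl | hHF := eq_or_ne H F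
    · exact .fixed (.inr hx)
    · exact .step (mem_without.2 ⟨hH, hHF⟩) hHG ih hx

theorem AttacksVarFixing.of_without (h : (q.without F).AttacksVarFixing (V ∪ F.vars) G x) :
    q.AttacksVarFixing V G x := by
  induction h with
  | start hx hdet => exact .start hx fun hdet' => hdet (hdet'.without F)
  | step _ hH hx hy hdet ih =>
    exact ih.step (mem_without.1 hH).1 hx hy fun hdet' => hdet (hdet'.without F)

theorem AcyclicFixing.without (h : q.AcyclicFixing V) (F : Atom S) :
    (q.without F).AcyclicFixing (V ∪ F.vars) :=
  fun G hG => h G (Relation.TransGen.mono (fun _ _ ⟨hA, hB, hne, x, hx, hatt⟩ =>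
    ⟨(mem_without.1 hA).1, (mem_without.1 hB).1, hne, x, hx, hatt.of_without⟩) G G hG)

theorem AcyclicFixing.exists_unattacked (h : q.AcyclicFixing V) (hq : q ≠ []) :
    ∃ F ∈ q, ∀ G, ¬ q.AttacksFixing V G F := by
  have : Finite {F // F ∈ q} := q.finite_toSet
  let R (A B : {F // F ∈ q}) : Prop := Relation.TransGen (q.AttacksFixing V) A B
  have : IsTrans _ R := ⟨fun _ _ _ => Relation.TransGen.trans⟩
  have : Std.Irrefl R := ⟨fun A => h A⟩
  have : Nonempty {F // F ∈ q} := (List.exists_mem_of_ne_nil q hq).elim fun F hF => ⟨F, hF⟩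
  obtain ⟨F, -, hF⟩ :=
    (Finite.wellFounded_of_trans_of_irrefl R).has_min Set.univ Set.univ_nonempty
  exact ⟨F, F.2, fun G hG => hF ⟨G, hG.1⟩ (Set.mem_univ _) (.single hG)⟩

end CQ

/-! ## Certainty under fixed values of some variables -/

namespace CQ

variable {S : Schema} {q : CQ S} {V X : Set Var} {F : Atom S} {A : DbFact S}
  {θ τ : VarValuation S} {db r s : Database S}

/-- Some valuation that coincides with `θ` on `V` maps all atoms of `q` to facts of `r`. -/
def SatisfiedFixing (q : CQ S) (V : Set Var) (θ : VarValuation S) (r : Database S) : Prop :=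
  ∃ τ : VarValuation S, Set.EqOn θ.get τ.get V ∧ ∀ F ∈ q, τ.ground F ∈ r

/-- Every repair of `db` satisfies `q` with the variables in `V` fixed to their values
under `θ`. -/
def CertainFixing (q : CQ S) (V : Set Var) (θ : VarValuation S) (db : Database S) : Prop :=
  ∀ r, db.IsRepair r → q.SatisfiedFixing V θ r

theorem CertainFixing.congr (h : q.CertainFixing V θ db) (hθ : Set.EqOn θ.get τ.get V) :
    q.CertainFixing V τ db := fun r hr =>
  (h r hr).imp fun _ hρ => ⟨hθ.symm.trans hρ.1, hρ.2⟩

theorem certainFixing_empty : q.CertainFixing ∅ θ db ↔ q.CertainIn db := by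
  simp only [CertainFixing, SatisfiedFixing, CertainIn, SatisfiedIn, Set.eqOn_empty, true_and]

theorem certainFixing_nil : CertainFixing [] V θ db :=
  fun _ _ => ⟨θ, Set.eqOn_refl _ _, by simp⟩

theorem KeyDetermines.get_eq {x : Var} (hx : q.KeyDetermines V F x)
    (hV : Set.EqOn θ.get τ.get V) (hkey : Set.EqOn θ.get τ.get F.keyVars)
    (hq : ∀ G ∈ q, G ≠ F → (θ.ground G).KeyEqual (τ.ground G) → θ.ground G = τ.ground G) :
    θ.get x = τ.get x := by
  induction hx with
  | fixed hx => exact hV hx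
  | key hx => exact hkey hx
  | step hG hGF _ hx ih =>
    exact VarValuation.ground_eq_iff.1 (hq _ hG hGF (VarValuation.keyEqual_ground_iff.2 ih)) hx

/-- The witness takes its values from `θ` on the variables attacked by `F`, and from `τ`
elsewhere. -/
theorem exists_merge (hX : ∀ x ∈ X, ¬ q.AttacksVarFixing V F x)
    (hV : Set.EqOn θ.get τ.get V) (hkey : Set.EqOn θ.get τ.get F.keyVars)
    (hq : ∀ G ∈ q, G ≠ F → (θ.ground G).KeyEqual (τ.ground G) → θ.ground G = τ.ground G) :
    ∃ ρ : VarValuation S, Set.EqOn τ.get ρ.get X ∧ ρ.ground F = θ.ground F ∧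
      ∀ G ∈ q, ρ.ground G = θ.ground G ∨ ρ.ground G = τ.ground G := by
  obtain ⟨ρ, hρθ, hρτ⟩ := VarValuation.exists_piecewise {x | q.AttacksVarFixing V F x} θ τ
  have hρ_of_keyDetermines {x : Var} (hx : q.KeyDetermines V F x) : ρ.get x = θ.get x :=
    (hρτ fun hatt : q.AttacksVarFixing V F x => hatt.not_keyDetermines hx).trans
      (hx.get_eq hV hkey hq).symm
  refine ⟨ρ, fun x hx => (hρτ (hX x hx)).symm, VarValuation.ground_eq_iff.2 fun x hx => ?_,
    fun G hG => ?_⟩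
  · by_cases hdet : q.KeyDetermines V F x
    exacts [hρ_of_keyDetermines hdet, hρθ (.start hx hdet)]
  · by_cases hatt : ∃ x ∈ G.vars, q.AttacksVarFixing V F x
    · obtain ⟨x, hx, hxatt⟩ := hatt
      refine .inl (VarValuation.ground_eq_iff.2 fun y hy => ?_)
      by_cases hdet : q.KeyDetermines V F y
      exacts [hρ_of_keyDetermines hdet, hρθ (hxatt.step hG hx hy hdet)]
    · push Not at hatt
      exact .inr (VarValuation.ground_eq_iff.2 fun y hy => hρτ (hatt y hy))

/-- The instantiations of the variables in `X`, compatible with the values of the variables in `V`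
under `θ`, that extend to an embedding of `q` into `r`. -/
def instantiations (q : CQ S) (V X : Set Var) (θ : VarValuation S) (r : Database S) :
    Set (VarValuation S) :=
  {τ | Set.EqOn θ.get τ.get V ∧ q.SatisfiedFixing X τ r}

theorem instantiations_replace_subset (hq : q.SelfJoinFree) (hVX : V ⊆ X) (hF : F ∈ q)
    (hX : ∀ x ∈ X, ¬ q.AttacksVarFixing V F x) (hs : s.Consistent)
    (hτV : Set.EqOn θ.get τ.get V) (hτs : ∀ G ∈ q, τ.ground G ∈ s)
    (hA : (τ.ground F).KeyEqual A) :
    q.instantiations V X θ (s.replace (τ.ground F) A) ⊆ q.instantiations V X θ s := by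
  rintro σ ⟨hσV, ρ, hσρ, hρ⟩
  have hρs : ∀ G ∈ q, ρ.ground G ≠ A → ρ.ground G ∈ s := fun G hG hne =>
    ((Database.mem_replace.1 (hρ G hG)).resolve_left hne).2
  by_cases hρA : ρ.ground F = A
  · have hρs' : ∀ G ∈ q, G ≠ F → ρ.ground G ∈ s := fun G hG hGF => hρs G hG fun hGA =>
      hGF (hq.eq_of_rel_eq hG hF (congrArg DbFact.rel (hGA.trans hρA.symm)))
    obtain ⟨μ, hμX, hμF, hμ⟩ := exists_merge hX (hτV.symm.trans (hσV.trans (hσρ.mono hVX)))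
      (VarValuation.keyEqual_ground_iff.1 (hρA ▸ hA))
      fun G hG hGF => hs _ (hτs G hG) _ (hρs' G hG hGF)
    refine ⟨hσV, μ, hσρ.trans hμX, fun G hG => ?_⟩
    obtain rfl | hGF := eq_or_ne G F
    · exact hμF ▸ hτs G hG
    · rcases hμ G hG with h | h <;> rw [h]
      exacts [hτs G hG, hρs' G hG hGF]
  · refine ⟨hσV, ρ, hσρ, fun G hG => hρs G hG fun hGA => hρA ?_⟩
    rwa [hq.eq_of_rel_eq hF hG (hA.rel_eq.trans (congrArg DbFact.rel hGA).symm)]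

theorem exists_isRepair_instantiations_subset (hq : q.SelfJoinFree) (hVX : V ⊆ X)
    (hX : ∀ F ∈ q, ∀ x ∈ X, ¬ q.AttacksVarFixing V F x) (θ : VarValuation S)
    (hr : db.IsRepair r) (hs : db.IsRepair s) :
    ∃ t, db.IsRepair t ∧ q.instantiations V X θ t ⊆ q.instantiations V X θ r ∧
      q.instantiations V X θ t ⊆ q.instantiations V X θ s := by
  classical
  induction hd : s \ r using Finset.strongInduction generalizing s with
  | H d ih =>
  subst hd
  by_cases hall : ∀ τ : VarValuation S, Set.EqOn θ.get τ.get V → (∀ G ∈ q, τ.ground G ∈ s) →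
      ∀ G ∈ q, τ.ground G ∈ r
  · refine ⟨s, hs, fun σ ⟨hσV, ρ, hσρ, hρ⟩ => ?_, subset_rfl⟩
    exact ⟨hσV, ρ, hσρ, hall ρ (hσV.trans (hσρ.mono hVX)) hρ⟩
  · push Not at hall
    obtain ⟨τ, hτV, hτs, F, hF, hτr⟩ := hall
    obtain ⟨A, hA, hτA⟩ := hr.exists_keyEqual (hs.subset (hτs F hF))
    obtain ⟨t, ht, htr, hts⟩ := ih _ (Database.replace_sdiff_ssubset hA (hτs F hF) hτr)
      (hs.replace (hr.subset hA) (hτs F hF) hτA.symm) rfl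
    exact ⟨t, ht, htr, hts.trans
      (instantiations_replace_subset hq hVX hF (hX F hF) hs.consistent hτV hτs hτA)⟩

theorem certainFixing_iff_exists (hq : q.SelfJoinFree) (hVX : V ⊆ X)
    (hX : ∀ F ∈ q, ∀ x ∈ X, ¬ q.AttacksVarFixing V F x) :
    q.CertainFixing V θ db ↔ ∃ τ, Set.EqOn θ.get τ.get V ∧ q.CertainFixing X τ db := by
  refine ⟨fun h => ?_, fun ⟨τ, hτV, hτ⟩ => ?_⟩
  · have : Nonempty {r // db.IsRepair r} := nonempty_subtype.2 db.exists_isRepair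
    have : Finite {r // db.IsRepair r} := db.finite_setOf_isRepair.to_subtype
    have hdir : Directed (· ⊇ ·) fun r : {r // db.IsRepair r} => q.instantiations V X θ r :=
      fun r s =>
        let ⟨t, ht, htr, hts⟩ := exists_isRepair_instantiations_subset hq hVX hX θ r.2 s.2
        ⟨⟨t, ht⟩, htr, hts⟩
    obtain ⟨t, ht⟩ := hdir.finite_le id
    obtain ⟨τ, hτV, hτt⟩ := h t t.2
    have hτ : τ ∈ q.instantiations V X θ t := ⟨hτV, τ, Set.eqOn_refl _ _, hτt⟩
    exact ⟨τ, hτV, fun r hr => (ht ⟨r, hr⟩ hτ).2⟩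
  · exact fun r hr => (hτ r hr).imp fun _ hρ => ⟨hτV.trans (hρ.1.mono hVX), hρ.2⟩

end CQ

/-- The block of `θ(F)` in `db` is nonempty, and each of its facts is the image of `F` under some
valuation that satisfies `P` and coincides with `θ` on `V`. -/
def Atom.BlockHolds {S : Schema} (F : Atom S) (db : Database S) (V : Set Var)
    (P : VarValuation S → Prop) (θ : VarValuation S) : Prop :=
  (∃ A ∈ db, (θ.ground F).KeyEqual A) ∧
    ∀ A ∈ db, (θ.ground F).KeyEqual A → ∃ τ, Set.EqOn θ.get τ.get V ∧ τ.ground F = A ∧ P τ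

namespace CQ

variable {S : Schema} {q : CQ S} {V : Set Var} {F : Atom S}
  {θ τ : VarValuation S} {db : Database S}

theorem CertainFixing.without (hq : q.SelfJoinFree) (hF : F ∈ q)
    (hkey : (F.keyVars : Set Var) ⊆ V) (h : q.CertainFixing V θ db) (hA : τ.ground F ∈ db)
    (hτ : Set.EqOn θ.get τ.get V) : (q.without F).CertainFixing (V ∪ F.vars) τ db := by
  intro r hr
  obtain ⟨B, hB, hτB⟩ := hr.exists_keyEqual hA
  -- The repair in which the block of `τ(F)` is represented by `τ(F)` itself.
  have hr' := hr.replace hA hB hτB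
  obtain ⟨ρ, hρV, hρ⟩ := h _ hr'
  have hτρ : τ.ground F = ρ.ground F :=
    hr'.consistent _ (Database.mem_replace.2 (.inl rfl)) _ (hρ F hF)
      (VarValuation.keyEqual_ground_iff.2 ((hτ.symm.trans hρV).mono hkey))
  refine ⟨ρ, (hτ.symm.trans hρV).union (VarValuation.ground_eq_iff.1 hτρ), fun G hG => ?_⟩
  obtain ⟨hG, hGF⟩ := mem_without.1 hG
  refine ((Database.mem_replace.1 (hρ G hG)).resolve_left fun hGτ => hGF ?_).2
  exact hq.eq_of_rel_eq hG hF (congrArg DbFact.rel hGτ)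

theorem CertainFixing.blockHolds (hq : q.SelfJoinFree) (hF : F ∈ q)
    (hkey : (F.keyVars : Set Var) ⊆ V) (h : q.CertainFixing V θ db) :
    F.BlockHolds db V (fun τ => (q.without F).CertainFixing (V ∪ F.vars) τ db) θ := by
  have hkeyEqual {τ : VarValuation S} (hτ : Set.EqOn θ.get τ.get V) :
      (θ.ground F).KeyEqual (τ.ground F) := VarValuation.keyEqual_ground_iff.2 (hτ.mono hkey)
  constructor
  · obtain ⟨r, hr⟩ := db.exists_isRepair
    obtain ⟨τ, hτV, hτ⟩ := h r hr
    exact ⟨τ.ground F, hr.subset (hτ F hF), hkeyEqual hτV⟩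
  · intro A hA hθA
    obtain ⟨r, hr, hAr⟩ := Database.exists_isRepair_mem hA
    obtain ⟨τ, hτV, hτ⟩ := h r hr
    obtain rfl : τ.ground F = A :=
      hr.consistent _ (hτ F hF) A hAr ((hkeyEqual hτV).symm.trans hθA)
    exact ⟨τ, hτV, rfl, h.without hq hF hkey hA hτV⟩

theorem certainFixing_of_blockHolds
    (h : F.BlockHolds db V (fun τ => (q.without F).CertainFixing (V ∪ F.vars) τ db) θ) :
    q.CertainFixing V θ db := by
  intro r hr
  obtain ⟨⟨A, hA, hθA⟩, hblock⟩ := h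
  obtain ⟨B, hB, hAB⟩ := hr.exists_keyEqual hA
  obtain ⟨τ, hτV, rfl, hτ⟩ := hblock B (hr.subset hB) (hθA.trans hAB)
  obtain ⟨ρ, hρ, hρr⟩ := hτ r hr
  refine ⟨ρ, hτV.trans (hρ.mono Set.subset_union_left), fun G hG => ?_⟩
  obtain rfl | hGF := eq_or_ne G F
  · rwa [← VarValuation.ground_eq_iff.2 (hρ.mono Set.subset_union_right)]
  · exact hρr G (mem_without.2 ⟨hG, hGF⟩)

theorem certainFixing_iff_blockHolds (hq : q.SelfJoinFree) (hF : F ∈ q)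
    (hkey : (F.keyVars : Set Var) ⊆ V) :
    q.CertainFixing V θ db ↔
      F.BlockHolds db V (fun τ => (q.without F).CertainFixing (V ∪ F.vars) τ db) θ :=
  ⟨CertainFixing.blockHolds hq hF hkey, certainFixing_of_blockHolds⟩

end CQ

/-! ## First-order definable conditions -/

namespace VarValuation

variable {S : Schema} {θ τ : VarValuation S}

theorem agreeOff_empty_iff : θ.AgreeOff ∅ τ ↔ τ = θ := by
  rw [agreeOff_iff, Finset.coe_empty, Set.compl_empty, Set.eqOn_univ, get_injective.eq_iff]

theorem agreeOff_union_iff {ys zs : Finset Var} :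
    θ.AgreeOff (ys ∪ zs) τ ↔ ∃ ρ, θ.AgreeOff ys ρ ∧ ρ.AgreeOff zs τ := by
  constructor
  · intro h
    obtain ⟨ρ, hρ, hρτ⟩ := exists_agreeOff_eqOn ys θ τ
    refine ⟨ρ, hρ, fun x hx => ?_⟩
    by_cases hxys : x ∈ ys
    · exact (hρτ hxys).symm
    · rw [h x (by simp [hxys, hx]), hρ x hxys]
  · rintro ⟨ρ, hρ, hτ⟩ x hx
    rw [Finset.notMem_union] at hx
    rw [hτ x hx.2, hρ x hx.1]

theorem exists_eqOn_and_iff {V X : Finset Var} {P : VarValuation S → Prop}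
    (hP : ∀ ⦃θ τ : VarValuation S⦄, Set.EqOn θ.get τ.get X → P θ → P τ) :
    (∃ τ, Set.EqOn θ.get τ.get V ∧ P τ) ↔ ∃ τ, θ.AgreeOff (X \ V) τ ∧ P τ := by
  constructor
  · rintro ⟨τ, hτV, hτ⟩
    obtain ⟨ρ, hρ, hρτ⟩ := exists_agreeOff_eqOn (X \ V) θ τ
    refine ⟨ρ, hρ, hP (fun x hx => ?_) hτ⟩
    by_cases hxV : x ∈ V
    · rw [hρ x (by simp [hxV]), hτV hxV]
    · exact (hρτ (Finset.mem_sdiff.2 ⟨hx, hxV⟩)).symm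
  · rintro ⟨τ, hτ, hPτ⟩
    exact ⟨τ, hτ.eqOn (Finset.disjoint_coe.2 Finset.disjoint_sdiff), hPτ⟩

theorem exists_eqOn_ground_eq_iff {V : Set Var} {F G : Atom S} {P : VarValuation S → Prop}
    (hG : Disjoint (G.vars : Set Var) (V ∪ F.vars))
    (hP : ∀ ⦃θ τ : VarValuation S⦄, Set.EqOn θ.get τ.get (V ∪ F.vars) → P θ → P τ) :
    (∃ τ, Set.EqOn θ.get τ.get (V ∪ G.vars) ∧ τ.ground F = τ.ground G ∧ P τ) ↔
      ∃ τ, Set.EqOn θ.get τ.get V ∧ τ.ground F = θ.ground G ∧ P τ := by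
  constructor
  · rintro ⟨τ, hτ, hFG, hPτ⟩
    have hτG : θ.ground G = τ.ground G := ground_eq_iff.2 (hτ.mono Set.subset_union_right)
    exact ⟨τ, hτ.mono Set.subset_union_left, hFG.trans hτG.symm, hPτ⟩
  · rintro ⟨τ, hτV, hFG, hPτ⟩
    obtain ⟨ρ, hρG, hρ⟩ := exists_piecewise G.vars θ τ
    have hτρ : Set.EqOn τ.get ρ.get (V ∪ F.vars) := hρ.symm.mono hG.subset_compl_left
    refine ⟨ρ, (hτV.trans (hτρ.mono Set.subset_union_left)).union hρG.symm, ?_, hP hτρ hPτ⟩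
    rw [ground_eq_iff.2 hρG, ← hFG, ground_eq_iff.2 (hτρ.mono Set.subset_union_right)]

end VarValuation

/-- Every fact over the relation of `G` is the image of `G` under some valuation that differs from a
given one at most on `G.vars`: quantifying these variables amounts to quantifying the fact. -/
def Atom.IsGeneric {S : Schema} (G : Atom S) : Prop :=
  ∀ (θ : VarValuation S) (A : DbFact S), A.rel = G.rel →
    ∃ τ, θ.AgreeOff G.vars τ ∧ τ.ground G = A

namespace Atom

variable {S : Schema}

theorem isGeneric_of_injective {G : Atom S} {v : Fin (S.arity G.rel) → Var}
    (hv : Function.Injective v) (hG : ∀ i, G.args i = .var (v i))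
    (hnum : ∀ i n, v i = .num n → i ∈ S.numeric G.rel) : G.IsGeneric := by
  rintro θ ⟨R, a, ha⟩ hA
  obtain rfl : R = G.rel := hA
  obtain ⟨σ, hσ⟩ := VarValuation.exists_get_eq (v := Function.extend v a θ.get) fun n => by
    by_cases hn : ∃ i, v i = .num n
    · obtain ⟨i, hi⟩ := hn
      rw [← hi, hv.extend_apply]
      exact ha i (hnum i n hi)
    · rw [Function.extend_apply' _ _ _ hn]
      exact θ.get_num_mem_range n
  have hargs : ∀ i, σ.termVal (G.args i) = a i := fun i => by
    rw [hG, VarValuation.termVal, hσ, hv.extend_apply]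
  refine ⟨σ, fun x hx => ?_, DbFact.eq_iff_exists_args_eq.2 ⟨rfl, hargs⟩⟩
  rw [hσ, Function.extend_apply']
  rintro ⟨i, rfl⟩
  exact hx (mem_vars.2 ⟨i, by simp [hG, Term.vars]⟩)

end Atom

/-- The number of a variable within its sort, used to choose variables outside a given set. -/
def Var.index : Var → ℕ
  | .obj n => n
  | .num n => n

theorem Atom.exists_isGeneric {S : Schema} (R : S.Rel) (U : Finset Var) :
    ∃ G : Atom S, G.rel = R ∧ Disjoint G.vars U ∧ G.IsGeneric := by
  classical
  obtain ⟨N, hN⟩ := (U.image Var.index).exists_nat_subset_range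
  let v (i : Fin (S.arity R)) : Var := if i ∈ S.numeric R then .num (N + i) else .obj (N + i)
  have hindex : ∀ i, (v i).index = N + i := fun i => by dsimp only [v]; split_ifs <;> rfl
  let G : Atom S := ⟨R, fun i => .var (v i), fun i hi =>
    ⟨.var (N + i), by simp [v, hi, NumPrim.toTerm]⟩⟩
  refine ⟨G, rfl, Finset.disjoint_left.2 fun x hxG hxU => ?_,
    isGeneric_of_injective (v := v) (fun i j hij => ?_) (fun _ => rfl) fun i n hi => ?_⟩
  · obtain ⟨i, hi⟩ := mem_vars.1 hxG
    obtain rfl : x = v i := Finset.mem_singleton.1 hi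
    have hlt := Finset.mem_range.1 (hN (Finset.mem_image_of_mem _ hxU))
    rw [hindex] at hlt
    omega
  · have hij' := congrArg Var.index hij
    rw [hindex, hindex] at hij'
    exact Fin.ext (by omega)
  · by_contra hnum
    simp [v, show i ∉ S.numeric R from hnum] at hi

/-- Some first-order formula with free variables in `V` expresses the condition `P` on a database
instance and a valuation. -/
def FirstOrderDefinable {S : Schema} (V : Finset Var)
    (P : Database S → VarValuation S → Prop) : Prop :=
  ∃ φ : Formula S, φ.WellFormed ∧ φ.freeVars ⊆ V ∧ ∀ db θ, φ.Holds db θ ↔ P db θ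

namespace FirstOrderDefinable

variable {S : Schema} {V W X : Finset Var} {P Q : Database S → VarValuation S → Prop}

theorem mono (hP : FirstOrderDefinable V P) (hVW : V ⊆ W) : FirstOrderDefinable W P :=
  hP.imp fun _ hφ => ⟨hφ.1, hφ.2.1.trans hVW, hφ.2.2⟩

theorem congr (hP : FirstOrderDefinable V P) (h : ∀ db θ, P db θ ↔ Q db θ) :
    FirstOrderDefinable V Q :=
  hP.imp fun _ hφ => ⟨hφ.1, hφ.2.1, fun db θ => (hφ.2.2 db θ).trans (h db θ)⟩

theorem verum : FirstOrderDefinable (S := S) V fun _ _ => True :=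
  ⟨.verum, trivial, Finset.empty_subset V, fun _ _ => by simp only [Formula.Holds]⟩

protected theorem not (hP : FirstOrderDefinable V P) :
    FirstOrderDefinable V fun db θ => ¬ P db θ := by
  obtain ⟨φ, hwf, hfree, hφ⟩ := hP
  exact ⟨.neg φ, hwf, hfree, fun db θ => by simp only [Formula.Holds, hφ]⟩

protected theorem and (hP : FirstOrderDefinable V P) (hQ : FirstOrderDefinable V Q) :
    FirstOrderDefinable V fun db θ => P db θ ∧ Q db θ := by
  obtain ⟨φ, hφwf, hφfree, hφ⟩ := hP
  obtain ⟨ψ, hψwf, hψfree, hψ⟩ := hQ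
  exact ⟨.and φ ψ, ⟨hφwf, hψwf⟩, Finset.union_subset hφfree hψfree,
    fun db θ => by simp only [Formula.Holds, hφ, hψ]⟩

theorem ground_mem (F : Atom S) : FirstOrderDefinable F.vars fun db θ => θ.ground F ∈ db :=
  ⟨.atom F, trivial, subset_rfl, fun _ _ => by simp only [Formula.Holds]⟩

theorem termVal_eq (s t : Term S) :
    FirstOrderDefinable (s.vars ∪ t.vars) fun _ θ => θ.termVal s = θ.termVal t :=
  ⟨.eq s t, trivial, subset_rfl, fun _ _ => by simp only [Formula.Holds]⟩

theorem forall_of_finite {ι : Sort*} [Finite ι] {P : ι → Database S → VarValuation S → Prop}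
    (hP : ∀ i, FirstOrderDefinable V (P i)) : FirstOrderDefinable V fun db θ => ∀ i, P i db θ := by
  obtain ⟨n, ⟨e⟩⟩ := Finite.exists_equiv_fin ι
  suffices h : ∀ R : Fin n → Database S → VarValuation S → Prop,
      (∀ k, FirstOrderDefinable V (R k)) → FirstOrderDefinable V fun db θ => ∀ k, R k db θ from
    (h (fun k => P (e.symm k)) fun _ => hP _).congr fun db θ =>
      e.symm.forall_congr_right (q := fun i => P i db θ)
  clear e
  intro R hR
  induction n with
  | zero => exact verum.congr fun _ _ => by simp only [IsEmpty.forall_iff]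
  | succ n ih =>
    exact ((hR 0).and (ih _ fun k => hR k.succ)).congr fun db θ =>
      (Fin.forall_fin_succ (P := fun k => R k db θ)).symm

theorem exists_of_finite {ι : Sort*} [Finite ι] {P : ι → Database S → VarValuation S → Prop}
    (hP : ∀ i, FirstOrderDefinable V (P i)) : FirstOrderDefinable V fun db θ => ∃ i, P i db θ :=
  (forall_of_finite fun i => (hP i).not).not.congr fun _ _ => by push Not; rfl

theorem exists_agreeOff {ys : Finset Var} (hP : FirstOrderDefinable (V ∪ ys) P) :
    FirstOrderDefinable V fun db θ => ∃ τ, θ.AgreeOff ys τ ∧ P db τ := by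
  induction ys using Finset.induction_on generalizing P with
  | empty =>
    rw [Finset.union_empty] at hP
    exact hP.congr fun _ _ => by simp only [VarValuation.agreeOff_empty_iff, exists_eq_left]
  | insert x ys _ ih =>
    obtain ⟨φ, hwf, hfree, hφ⟩ := hP
    have hx : FirstOrderDefinable (V ∪ ys) fun db θ => ∃ τ, θ.AgreeOff {x} τ ∧ P db τ := by
      rw [Finset.union_insert, Finset.subset_insert_iff, Finset.erase_eq] at hfree
      exact ⟨.ex x φ, hwf, hfree, fun db θ => by simp only [Formula.Holds, hφ]⟩
    refine (ih hx).congr fun db θ => ?_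
    simp only [Finset.insert_eq, Finset.union_comm {x} ys, VarValuation.agreeOff_union_iff]
    exact ⟨fun ⟨ρ, hρ, τ, hτ, h⟩ => ⟨τ, ⟨ρ, hρ, hτ⟩, h⟩,
      fun ⟨τ, ⟨ρ, hρ, hτ⟩, h⟩ => ⟨ρ, hρ, τ, hτ, h⟩⟩

theorem exists_eqOn (hP : FirstOrderDefinable X P)
    (hcongr : ∀ db ⦃θ τ : VarValuation S⦄, Set.EqOn θ.get τ.get X → P db θ → P db τ) :
    FirstOrderDefinable V fun db θ => ∃ τ, Set.EqOn θ.get τ.get V ∧ P db τ := by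
  have hX : FirstOrderDefinable (V ∪ X \ V) P :=
    hP.mono (Finset.subset_union_right.trans Finset.union_sdiff_self_eq_union.ge)
  exact hX.exists_agreeOff.congr fun db _ => (VarValuation.exists_eqOn_and_iff (hcongr db)).symm

theorem ground_eq (F G : Atom S) :
    FirstOrderDefinable (F.vars ∪ G.vars) fun _ θ => θ.ground F = θ.ground G := by
  have h : FirstOrderDefinable (F.vars ∪ G.vars) fun _ θ => ∃ hrel : F.rel = G.rel,
      ∀ i, θ.termVal (F.args i) = θ.termVal (G.args (Fin.cast (congrArg S.arity hrel) i)) :=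
    exists_of_finite fun _ => forall_of_finite fun _ =>
      (termVal_eq _ _).mono (Finset.union_subset_union
        (fun _ hx => Atom.mem_vars.2 ⟨_, hx⟩) fun _ hx => Atom.mem_vars.2 ⟨_, hx⟩)
  exact h.congr fun _ θ =>
    (DbFact.eq_iff_exists_args_eq (A := θ.ground F) (B := θ.ground G)).symm

theorem keyEqual (F G : Atom S) :
    FirstOrderDefinable (F.keyVars ∪ G.keyVars) fun _ θ => (θ.ground F).KeyEqual (θ.ground G) := by
  have h : FirstOrderDefinable (F.keyVars ∪ G.keyVars) fun _ θ => ∃ hrel : F.rel = G.rel,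
      ∀ i : Fin (S.arity F.rel), i.val < S.keyLen F.rel →
        θ.termVal (F.args i) = θ.termVal (G.args (Fin.cast (congrArg S.arity hrel) i)) :=
    exists_of_finite fun hrel => forall_of_finite fun _ => forall_of_finite fun hi =>
      (termVal_eq _ _).mono (Finset.union_subset_union
        (fun _ hx => Atom.mem_keyVars.2 ⟨_, hi, hx⟩)
        fun _ hx => Atom.mem_keyVars.2 ⟨_, hi.trans_eq (congrArg S.keyLen hrel), hx⟩)
  exact h

theorem exists_mem {R : S.Rel} {Q : Database S → VarValuation S → DbFact S → Prop} (U : Finset Var)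
    (hVU : V ⊆ U) (hrel : ∀ ⦃db θ A⦄, Q db θ A → A.rel = R)
    (hcongr : ∀ ⦃db θ τ A⦄, Set.EqOn θ.get τ.get V → Q db θ A → Q db τ A)
    (hQ : ∀ G : Atom S, Disjoint G.vars U →
      FirstOrderDefinable (V ∪ G.vars) fun db θ => Q db θ (θ.ground G)) :
    FirstOrderDefinable V fun db θ => ∃ A ∈ db, Q db θ A := by
  obtain ⟨G, hG, hGU, hgen⟩ := Atom.exists_isGeneric R U
  have hVG {θ τ : VarValuation S} (h : θ.AgreeOff G.vars τ) : Set.EqOn θ.get τ.get V :=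
    h.eqOn (Finset.disjoint_coe.2 (hGU.symm.mono_left hVU))
  refine (((ground_mem G).mono Finset.subset_union_right).and (hQ G hGU)).exists_agreeOff.congr
    fun db θ => ⟨?_, ?_⟩
  · rintro ⟨τ, hτ, hmem, h⟩
    exact ⟨τ.ground G, hmem, hcongr (hVG hτ).symm h⟩
  · rintro ⟨A, hA, h⟩
    obtain ⟨τ, hτ, rfl⟩ := hgen θ A ((hrel h).trans hG.symm)
    exact ⟨τ, hτ, hA, hcongr (hVG hτ) h⟩

theorem exists_eqOn_ground_eq {F G : Atom S} (hP : FirstOrderDefinable (V ∪ F.vars) P)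
    (hcongr : ∀ db ⦃θ τ : VarValuation S⦄,
      Set.EqOn θ.get τ.get (V ∪ F.vars : Set Var) → P db θ → P db τ)
    (hG : Disjoint G.vars (V ∪ F.vars)) :
    FirstOrderDefinable (V ∪ G.vars) fun db θ =>
      ∃ τ, Set.EqOn θ.get τ.get V ∧ τ.ground F = θ.ground G ∧ P db τ := by
  have hFG : FirstOrderDefinable (V ∪ F.vars ∪ G.vars)
      fun db θ => θ.ground F = θ.ground G ∧ P db θ :=
    ((ground_eq F G).mono (Finset.union_subset_union_left Finset.subset_union_right)).and
      (hP.mono Finset.subset_union_left)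
  refine (hFG.exists_eqOn fun db θ τ hθτ ⟨hground, hPθ⟩ => ?_).congr fun db θ => ?_
  · rw [Finset.coe_union, Finset.coe_union, Set.union_assoc, Set.eqOn_union, Set.eqOn_union] at hθτ
    rw [← VarValuation.ground_eq_iff.2 hθτ.2.1, ← VarValuation.ground_eq_iff.2 hθτ.2.2]
    exact ⟨hground, hcongr db (hθτ.1.union hθτ.2.1) hPθ⟩
  · rw [Finset.coe_union]
    exact VarValuation.exists_eqOn_ground_eq_iff
      (by rwa [← Finset.coe_union, Finset.disjoint_coe]) (hcongr db)

theorem blockHolds {F : Atom S} (hkey : F.keyVars ⊆ V) (hP : FirstOrderDefinable (V ∪ F.vars) P)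
    (hcongr : ∀ db ⦃θ τ : VarValuation S⦄,
      Set.EqOn θ.get τ.get (V ∪ F.vars : Set Var) → P db θ → P db τ) :
    FirstOrderDefinable V fun db θ => F.BlockHolds db V (P db) θ := by
  have hkeyEqual_congr {θ τ : VarValuation S} {A : DbFact S} (hθτ : Set.EqOn θ.get τ.get V)
      (h : (θ.ground F).KeyEqual A) : (τ.ground F).KeyEqual A :=
    (VarValuation.keyEqual_ground_iff.2 (hθτ.symm.mono hkey)).trans h
  have hkeyEqual (G : Atom S) : FirstOrderDefinable (V ∪ G.vars)
      fun _ θ => (θ.ground F).KeyEqual (θ.ground G) :=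
    (keyEqual F G).mono (Finset.union_subset_union hkey G.keyVars_subset_vars)
  have hnonempty : FirstOrderDefinable V fun db θ => ∃ A ∈ db, (θ.ground F).KeyEqual A :=
    exists_mem V subset_rfl (fun _ _ _ h => h.rel_eq.symm)
      (fun _ _ _ _ hθτ => hkeyEqual_congr hθτ) fun G _ => hkeyEqual G
  have hfailing : FirstOrderDefinable V fun db θ => ∃ A ∈ db, (θ.ground F).KeyEqual A ∧
      ¬ ∃ τ, Set.EqOn θ.get τ.get V ∧ τ.ground F = A ∧ P db τ :=
    exists_mem (V ∪ F.vars) Finset.subset_union_left (fun _ _ _ h => h.1.rel_eq.symm)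
      (fun _ _ _ _ hθτ h => ⟨hkeyEqual_congr hθτ h.1,
        fun ⟨ρ, hρ, hρP⟩ => h.2 ⟨ρ, hθτ.trans hρ, hρP⟩⟩)
      fun G hG => (hkeyEqual G).and (hP.exists_eqOn_ground_eq hcongr hG).not
  refine (hnonempty.and hfailing.not).congr fun db θ => and_congr_right fun _ => ?_
  push Not
  rfl

end FirstOrderDefinable

namespace CQ

variable {S : Schema} {q : CQ S}

theorem firstOrderDefinable_certainFixing {V : Finset Var} (hq : q.SelfJoinFree)
    (hacyclic : q.AcyclicFixing V) :
    FirstOrderDefinable V fun db θ => q.CertainFixing V θ db := by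
  induction hn : q.length using Nat.strong_induction_on generalizing q V with
  | _ n ih =>
  subst hn
  obtain rfl | hne := eq_or_ne q []
  · exact FirstOrderDefinable.verum.congr fun _ _ => iff_of_true trivial certainFixing_nil
  obtain ⟨F, hF, hatt⟩ := hacyclic.exists_unattacked hne
  let W := V ∪ F.keyVars
  have hWF : W ∪ F.vars = V ∪ F.vars := by
    rw [Finset.union_assoc, Finset.union_eq_right.2 F.keyVars_subset_vars]
  have hrest : FirstOrderDefinable (W ∪ F.vars)
      fun db θ => (q.without F).CertainFixing (W ∪ F.vars) θ db := by
    have hacyclic' := hacyclic.without F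
    rw [← Finset.coe_union, ← hWF] at hacyclic'
    simpa only [Finset.coe_union] using
      ih _ (length_without_lt hF) (hq.without F) hacyclic' rfl
  have hW : FirstOrderDefinable W fun db θ => q.CertainFixing W θ db :=
    (FirstOrderDefinable.blockHolds Finset.subset_union_right hrest
      fun _ _ _ hθτ h => h.congr hθτ).congr fun _ _ =>
        (certainFixing_iff_blockHolds hq hF (Finset.coe_subset.2 Finset.subset_union_right)).symm
  have hunattacked : ∀ G ∈ q, ∀ x ∈ (W : Set Var), ¬ q.AttacksVarFixing V G x := by
    intro G hG x hx hGx
    obtain hxV | hxF := Finset.mem_union.1 hx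
    · exact hGx.not_keyDetermines (.fixed hxV)
    · obtain rfl | hGF := eq_or_ne G F
      · exact hGx.not_keyDetermines (.key hxF)
      · exact hatt G ⟨hG, hF, hGF, x, F.keyVars_subset_vars hxF, hGx⟩
  exact (hW.exists_eqOn fun _ _ _ hθτ h => h.congr hθτ).congr fun _ _ =>
    (certainFixing_iff_exists hq (Finset.coe_subset.2 Finset.subset_union_left) hunattacked).symm

theorem firstOrderDefinable_certainIn (hq : q.SelfJoinFree) (hacyclic : q.AcyclicAttackGraph) :
    FirstOrderDefinable ∅ fun db (_ : VarValuation S) => q.CertainIn db :=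
  (firstOrderDefinable_certainFixing hq
    (Finset.coe_empty (α := Var) ▸ hacyclic.acyclicFixing)).congr fun _ _ => by
      rw [Finset.coe_empty, certainFixing_empty]

end CQ

/-! ## Aggregation queries over repairs -/

namespace CQ

variable {S : Schema} {q : CQ S} {db r : Database S} {θ : VarValuation S}

theorem holds_body : q.body.Holds db θ ↔ ∀ F ∈ q, θ.ground F ∈ db := by
  induction q with
  | nil => simp [body, Formula.Holds]
  | cons F q ih => simp only [body, List.foldr_cons, Formula.Holds] at ih ⊢; simp [ih]

theorem freeVars_body (q : CQ S) : q.body.freeVars = q.vars := by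
  induction q with
  | nil => rfl
  | cons F q ih => exact congrArg (F.vars ∪ ·) ih

theorem wellFormed_body (q : CQ S) : q.body.WellFormed := by
  induction q with
  | nil => trivial
  | cons F q ih => exact ⟨trivial, ih⟩

/-- The valuations of the variables of `q`, extended by `θ` to all variables, that map the atoms of
`q` to facts of `db`. -/
def embeddings (q : CQ S) (db : Database S) (θ : VarValuation S) : Set (VarValuation S) :=
  {τ | θ.AgreeOff q.vars τ ∧ ∀ F ∈ q, τ.ground F ∈ db}

theorem finite_embeddings (q : CQ S) (db : Database S) (θ : VarValuation S) :
    (q.embeddings db θ).Finite := by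
  have : Finite {F // F ∈ q} := q.finite_toSet
  let images (τ : q.embeddings db θ) (F : {F // F ∈ q}) : {A // A ∈ db} :=
    ⟨τ.1.ground F, τ.2.2 F F.2⟩
  refine Finite.of_injective images fun τ σ h => ?_
  refine Subtype.ext (VarValuation.get_injective (funext fun x => ?_))
  by_cases hx : x ∈ q.vars
  · obtain ⟨F, hF, hxF⟩ := mem_vars.1 hx
    exact VarValuation.ground_eq_iff.1 (congrArg Subtype.val (congrFun h ⟨F, hF⟩)) hxF
  · rw [τ.2.1 x hx, σ.2.1 x hx]

theorem embeddings_mono (q : CQ S) (h : r ⊆ db) (θ : VarValuation S) :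
    q.embeddings r θ ⊆ q.embeddings db θ :=
  fun _ hτ => ⟨hτ.1, fun F hF => h (hτ.2 F hF)⟩

theorem SatisfiedIn.nonempty_embeddings (h : q.SatisfiedIn db) (θ : VarValuation S) :
    (q.embeddings db θ).Nonempty := by
  obtain ⟨τ, hτ⟩ := h
  obtain ⟨ρ, hρ, hρτ⟩ := VarValuation.exists_agreeOff_eqOn q.vars θ τ
  refine ⟨ρ, hρ, fun F hF => ?_⟩
  rw [VarValuation.ground_eq_iff.2 fun x hx => hρτ (mem_vars.2 ⟨F, hF, hx⟩)]
  exact hτ F hF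

theorem SelfJoinFree.exists_isRepair (hq : q.SelfJoinFree) (hθ : ∀ F ∈ q, θ.ground F ∈ db) :
    ∃ r, db.IsRepair r ∧ ∀ F ∈ q, θ.ground F ∈ r := by
  classical
  have hcons : Database.Consistent (q.map θ.ground).toFinset := by
    intro A hA B hB hAB
    obtain ⟨F, hF, rfl⟩ := List.mem_map.1 (List.mem_toFinset.1 hA)
    obtain ⟨G, hG, rfl⟩ := List.mem_map.1 (List.mem_toFinset.1 hB)
    rw [hq.eq_of_rel_eq hF hG hAB.rel_eq]
  have hsub : (q.map θ.ground).toFinset ⊆ db := fun A hA => by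
    obtain ⟨F, hF, rfl⟩ := List.mem_map.1 (List.mem_toFinset.1 hA)
    exact hθ F hF
  obtain ⟨r, hr, himage⟩ := Database.exists_isRepair_superset hsub hcons
  exact ⟨r, hr, fun F hF => himage (List.mem_toFinset.2 (List.mem_map_of_mem hF))⟩

end CQ

namespace AggOp

variable {S : Schema}

theorem exists_min_over (f₀ : Option NNRat) {Θ : Set (VarValuation S)} (hfin : Θ.Finite)
    (hne : Θ.Nonempty) (p : NumPrim) :
    ∃ v, (AggOp.min f₀).over Θ p = some v ∧
      IsLeast ((VarValuation.primVal · p) '' Θ) v := by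
  classical
  have hX : (hfin.toFinset.val.map fun θ => θ.primVal p) ≠ 0 := by
    rwa [Ne, Multiset.map_eq_zero, Finset.val_eq_zero, hfin.toFinset_eq_empty,
      ← Ne, ← Set.nonempty_iff_ne_empty]
  have himage : ((hfin.toFinset.val.map fun θ => θ.primVal p).toFinset : Set NNRat) =
      (VarValuation.primVal · p) '' Θ := by
    ext x; simp
  refine ⟨_, by rw [AggOp.over, dif_pos hfin, AggOp.apply, dif_neg hX], ?_⟩
  rw [← himage]
  exact Finset.isLeast_min' _ (by simpa using hX)

theorem over_empty (F : AggOp) (p : NumPrim) :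
    F.over (∅ : Set (VarValuation S)) p = F.onEmpty := by
  simp [AggOp.over, AggOp.apply]

end AggOp

namespace AggQuery

variable {S : Schema} {g : AggQuery S} {db : Database S} {f₀ : Option NNRat}

theorem value_toNumTerm (g : AggQuery S) (db : Database S) :
    g.toNumTerm.value db = g.op.over (g.body.embeddings db (VarValuation.zero S)) g.head := by
  simp only [NumTerm.value, toNumTerm, NumTerm.eval, CQ.holds_body, CQ.embeddings]

theorem exists_value_eq_some_isLeast (hmin : g.op = AggOp.min f₀) (h : g.body.SatisfiedIn db) :
    ∃ u, g.toNumTerm.value db = some u ∧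
      IsLeast ((VarValuation.primVal · g.head) ''
        g.body.embeddings db (VarValuation.zero S)) u := by
  rw [value_toNumTerm, hmin]
  exact AggOp.exists_min_over f₀ (g.body.finite_embeddings _ _) (h.nonempty_embeddings _) _

theorem isGlbCQA_some (hmin : g.op = AggOp.min f₀) (hc : g.body.CertainIn db) {v : NNRat}
    (hv : IsLeast ((VarValuation.primVal · g.head) ''
      g.body.embeddings db (VarValuation.zero S)) v) : g.IsGlbCQA db (some v) := by
  have hle : ∀ r, db.IsRepair r → ∀ u, IsLeast ((VarValuation.primVal · g.head) ''
      g.body.embeddings r (VarValuation.zero S)) u → v ≤ u := fun r hr u hu =>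
    hv.2 (Set.image_mono (g.body.embeddings_mono hr.subset _) hu.1)
  refine ⟨hc, ?_, ?_⟩
  · obtain ⟨θ, ⟨hθ, hθdb⟩, hθv⟩ := hv.1
    obtain ⟨r, hr, hθr⟩ := g.selfJoinFree.exists_isRepair hθdb
    obtain ⟨u, hu, hleast⟩ := exists_value_eq_some_isLeast hmin (hc r hr)
    exact ⟨r, hr, hu.trans (congrArg some
      ((hleast.2 ⟨θ, ⟨hθ, hθr⟩, hθv⟩).antisymm (hle r hr u hleast)))⟩
  · rintro w ⟨r, hr, hw⟩
    obtain ⟨u, hu, hleast⟩ := exists_value_eq_some_isLeast hmin (hc r hr)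
    exact (hle r hr u hleast).trans_eq (Option.some.inj (hu.symm.trans hw))

theorem isGlbCQA_none (h : ¬ g.body.CertainIn db) : g.IsGlbCQA db none := by
  simp only [CQ.CertainIn, not_forall] at h
  obtain ⟨r, hr, hunsat⟩ := h
  exact ⟨r, hr, hunsat⟩

theorem isGlbCQA_min_over (hmin : g.op = AggOp.min f₀) (hc : g.body.CertainIn db)
    (f₁ : Option NNRat) :
    g.IsGlbCQA db
      ((AggOp.min f₁).over (g.body.embeddings db (VarValuation.zero S)) g.head) := by
  obtain ⟨r, hr⟩ := db.exists_isRepair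
  have hne : (g.body.embeddings db (VarValuation.zero S)).Nonempty :=
    ((hc r hr).nonempty_embeddings _).mono (g.body.embeddings_mono hr.subset _)
  obtain ⟨v, hv, hleast⟩ := AggOp.exists_min_over f₁ (g.body.finite_embeddings db _) hne g.head
  rw [hv]
  exact isGlbCQA_some hmin hc hleast

theorem glbExpressible_of_firstOrderDefinable (hmin : g.op = AggOp.min f₀)
    (hdef : FirstOrderDefinable ∅ fun db (_ : VarValuation S) => g.body.CertainIn db) :
    g.GlbExpressible := by
  obtain ⟨φ, hwf, hfree, hφ⟩ := hdef
  have hfreeVars : (Formula.and g.body.body φ).freeVars = g.body.vars := by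
    rw [Formula.freeVars, g.body.freeVars_body, Finset.subset_empty.1 hfree, Finset.union_empty]
  refine ⟨.agg (AggOp.min none) g.body.vars g.head (.and g.body.body φ), ⟨?_, ?_⟩, fun db => ?_⟩
  · refine ⟨hfreeVars.ge, hfreeVars.ge.trans' g.head_vars, ⟨g.body.wellFormed_body, hwf⟩,
      fun db θ => (g.body.finite_embeddings db θ).subset fun τ hτ => ⟨hτ.1, ?_⟩⟩
    exact CQ.holds_body.1 hτ.2.1
  · rw [NumTerm.freeVars, hfreeVars, Finset.sdiff_eq_empty_iff_subset]
    exact Finset.union_subset g.head_vars subset_rfl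
  · simp only [NumTerm.value, NumTerm.eval, Formula.Holds, CQ.holds_body, hφ]
    by_cases hc : g.body.CertainIn db
    · simp only [hc, and_true]
      exact isGlbCQA_min_over hmin hc none
    · simp only [hc, and_false, Set.ofPred_false, AggOp.over_empty]
      exact isGlbCQA_none hc

end AggQuery

theorem mainTheorem5 (S : Schema) (g : AggQuery S) (f₀ : Option NNRat)
    (hmin : g.op = AggOp.min f₀) (hacyclic : g.body.AcyclicAttackGraph) :
    g.GlbExpressible ∧
      ∀ db : Database S,
        (g.body.CertainIn db → g.IsGlbCQA db (g.toNumTerm.value db)) ∧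
        (¬ g.body.CertainIn db → g.IsGlbCQA db none) := by
  have hdef := CQ.firstOrderDefinable_certainIn g.selfJoinFree hacyclic
  refine ⟨AggQuery.glbExpressible_of_firstOrderDefinable hmin hdef,
    fun db => ⟨fun hc => ?_, AggQuery.isGlbCQA_none⟩⟩
  rw [g.value_toNumTerm, hmin]
  exact AggQuery.isGlbCQA_min_over hmin hc f₀
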